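/- Let $n \ge 1$, let $g_1, \dots, g_n$ be (possibly multivariate) polynomials over $\mathbb{C}$, and let $e_1, \dots, e_n$ be positive integers. Assume that $$g_1^{e_1} + g_2^{e_2} + \cdots + g_n^{e_n} \ne 0$$ and that no nonempty subsum of $g_1^{e_1} + g_2^{e_2} + \cdots + g_n^{e_n}$ vanishes. Let $d$ be the dimension of the vector space over $\mathbb{C}$ spanned by $g_1^{e_1}, \dots, g_n^{e_n}$, and let $k$ be the number of indices $i$ for which $g_i$ is constant. Then $$\left(\sum_{i=1}^{n} \frac{1}{e_i} - \frac{1}{d'-1}\right) \max_{1 \le m \le n} \deg g_m^{e_m} \;\ge\; \frac{d'}{2} - \frac{1}{d'-1} \deg \sum_{i=1}^{n} g_i^{e_i}$$ for all integers $d' \ge 2$ with $d \le d' \le n+1-k$; in particular, if no $g_i$ is constant, for all integers $d' \geq 2$ between $d$ and $n+1$ inclusive. Furthermore, if $n \ge 2$ and $\gcd\{g_1, \dots, g_n\} \ne 1$, then equality does not hold for any such $d'$. (Here $\deg$ is the total degree.) -/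

import Mathlib

namespace PowerSum

/-- The dimension of the complex vector space spanned by the polynomials `f i`. -/
noncomputable def spanDim {l n : ℕ} (f : Fin n → MvPolynomial (Fin l) ℂ) : ℕ :=
  Module.finrank ℂ (Submodule.span ℂ (Set.range f))

/-- The largest total degree among the polynomials `f i`. -/
def maxDegree {l n : ℕ} (f : Fin n → MvPolynomial (Fin l) ℂ) : ℕ :=
  Finset.univ.sup fun i => (f i).totalDegree

/-- The number of indices `i` for which `g i` is a constant polynomial. -/
def numConstant {l n : ℕ} (g : Fin n → MvPolynomial (Fin l) ℂ) : ℕ :=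
  (Finset.univ.filter fun i => (g i).totalDegree = 0).card

/-- The greatest common divisor of all the `g i` is `1` (up to units): every common divisor
is a unit. -/
def GcdEqOne {l n : ℕ} (g : Fin n → MvPolynomial (Fin l) ℂ) : Prop :=
  ∀ h : MvPolynomial (Fin l) ℂ, (∀ i, h ∣ g i) → IsUnit h

end PowerSum

open Polynomial

namespace PowerSum

/-! Restriction to a generic line through the origin keeps the degrees of all `g i` and of all
nonempty subsums, so it suffices to treat one variable. Write f_i = g_i^{e_i}, F = ∑ f_i, and let d
be the dimension of the span of the f_i. The Wronskian W of a basis of that span chosen among the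
f_i is nonzero. It is divisible by the product of the g_i^{e_i-(d-1)}, which bounds its degree
below. In any other basis of the same span W changes only by a constant factor, so deg W + d(d-1)/2
is at most the degree sum of that basis. The two bases are chosen greedily: one of largest degrees
among the f_i, one of smallest degrees among the f_i and F. Nonvanishing of subsums makes their
degree sums differ by at least deg f_m - deg F (`exists_bases_sum_weight_le`). Hence deg f_m +
d(d-1)/2 ≤ (d-1) ∑ deg g_i + deg F. Replacing d by d' only weakens this, since ∑ deg g_i ≥ d'-1.
Choosing f_m of maximal degree M and using deg g_i ≤ M/e_i gives the theorem. A nonconstant common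
factor of the g_i gives one more factor of W or slack elsewhere, hence strictness. -/

/-! ### Degree and nonvanishing of Wronskians -/

/-- The Wronskian determinant of a finite family of polynomials. -/
noncomputable def wronskianDet {K : Type*} [Field K] {d : ℕ} (v : Fin d → K[X]) : K[X] :=
  (Matrix.of fun i j : Fin d => derivative^[(i : ℕ)] (v j)).det

theorem coeff_prod_sum_of_natDegree_le {K ι : Type*} [Field K] (s : Finset ι) (p : ι → K[X])
    (D : ι → ℕ) (h : ∀ i ∈ s, (p i).natDegree ≤ D i) :
    (∏ i ∈ s, p i).coeff (∑ i ∈ s, D i) = ∏ i ∈ s, (p i).coeff (D i) := by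
  classical
  induction s using Finset.induction_on with
  | empty => simp
  | insert a s ha ih =>
    have h' : ∀ i ∈ s, (p i).natDegree ≤ D i := fun i hi => h i (Finset.mem_insert_of_mem hi)
    rw [Finset.prod_insert ha, Finset.sum_insert ha, Finset.prod_insert ha,
      coeff_mul_add_eq_of_natDegree_le (h a (Finset.mem_insert_self a s))
        ((natDegree_prod_le s p).trans (Finset.sum_le_sum h')), ih h']

theorem coeff_det_of_natDegree_le {K : Type*} [Field K] {d : ℕ}
    (A : Matrix (Fin d) (Fin d) K[X]) (D : Fin d → ℕ) (h : ∀ i j, (A i j).natDegree ≤ D j) :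
    A.det.coeff (∑ j, D j) = (Matrix.of fun i j => (A i j).coeff (D j)).det := by
  rw [Matrix.det_apply, Matrix.det_apply, finsetSum_coeff]
  refine Finset.sum_congr rfl fun σ _ => ?_
  rw [Units.smul_def, Units.smul_def, coeff_smul,
    coeff_prod_sum_of_natDegree_le _ _ _ fun i _ => h (σ i) i]
  rfl

theorem natDegree_det_le {K : Type*} [Field K] {d : ℕ}
    (A : Matrix (Fin d) (Fin d) K[X]) (D : Fin d → ℕ) (h : ∀ i j, (A i j).natDegree ≤ D j) :
    A.det.natDegree ≤ ∑ j, D j := by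
  rw [Matrix.det_apply]
  refine natDegree_sum_le_of_forall_le _ _ fun σ _ => ?_
  rw [Units.smul_def]
  exact (natDegree_smul_le _ _).trans
    ((natDegree_prod_le _ _).trans (Finset.sum_le_sum fun i _ => h (σ i) i))

theorem coeff_X_pow_mul_iterate_derivative {K : Type*} [Field K] (p : K[X]) (k m : ℕ) :
    (X ^ k * derivative^[k] p).coeff m = (m.descFactorial k : K) * p.coeff m := by
  rw [coeff_X_pow_mul']
  split_ifs with h
  · rw [coeff_iterate_derivative, Nat.sub_add_cancel h, nsmul_eq_mul]
  · rw [Nat.descFactorial_of_lt (not_le.mp h), Nat.cast_zero, zero_mul]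

theorem natDegree_X_pow_mul_iterate_derivative_le {K : Type*} [Field K] (p : K[X]) (k : ℕ) :
    (X ^ k * derivative^[k] p).natDegree ≤ p.natDegree := by
  refine natDegree_le_iff_coeff_eq_zero.mpr fun m hm => ?_
  rw [coeff_X_pow_mul_iterate_derivative, coeff_eq_zero_of_natDegree_lt hm, mul_zero]

/-- Scaling row i by X^i undoes the degree loss of differentiation: every entry of column j then has
degree at most that of `v j`. The scaling costs exactly the 0 + 1 + ... + (d-1) that sharpens the
degree bound. -/
theorem X_pow_mul_wronskianDet {K : Type*} [Field K] {d : ℕ} (v : Fin d → K[X]) :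
    X ^ (∑ i ∈ Finset.range d, i) * wronskianDet v =
      (Matrix.of fun i j : Fin d => X ^ (i : ℕ) * derivative^[(i : ℕ)] (v j)).det := by
  have := Matrix.det_mul_column (fun i : Fin d => (X : K[X]) ^ (i : ℕ))
    (Matrix.of fun i j : Fin d => derivative^[(i : ℕ)] (v j))
  rw [Finset.prod_pow_eq_pow_sum, Fin.sum_univ_eq_sum_range (fun i => i) d] at this
  exact this.symm

theorem natDegree_wronskianDet_add_le {K : Type*} [Field K] {d : ℕ} (v : Fin d → K[X])
    (hv : wronskianDet v ≠ 0) :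
    (wronskianDet v).natDegree + ∑ i ∈ Finset.range d, i ≤ ∑ j, (v j).natDegree := by
  have h := natDegree_det_le
    (Matrix.of fun i j : Fin d => X ^ (i : ℕ) * derivative^[(i : ℕ)] (v j))
    (fun j => (v j).natDegree) fun i j => natDegree_X_pow_mul_iterate_derivative_le (v j) i
  rw [← X_pow_mul_wronskianDet, natDegree_mul (pow_ne_zero _ X_ne_zero) hv, natDegree_X_pow] at h
  omega

/-- Descending factorials are monic polynomials of degrees 0, ..., d-1 evaluated at the `D j`, so
this is a Vandermonde determinant. -/
theorem det_descFactorial_ne_zero {K : Type*} [Field K] [CharZero K] {d : ℕ} (D : Fin d → ℕ)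
    (hD : Function.Injective D) :
    (Matrix.of fun i j : Fin d => ((D j).descFactorial i : K)).det ≠ 0 := by
  have h := Matrix.det_eval_matrixOfPolynomials_eq_det_vandermonde (fun j => (D j : K))
    (fun i : Fin d => descPochhammer K i) (fun i => descPochhammer_natDegree K i)
    (fun i => monic_descPochhammer K i)
  simp only [descPochhammer_eval_eq_descFactorial] at h
  rw [← Matrix.det_transpose]
  refine fun h0 => Matrix.det_vandermonde_ne_zero_iff.mpr ?_ (h.trans h0)
  exact fun i j hij => hD (Nat.cast_injective hij)

theorem wronskianDet_ne_zero_of_injective {K : Type*} [Field K] [CharZero K] {d : ℕ}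
    (v : Fin d → K[X]) (hv : ∀ j, v j ≠ 0)
    (hinj : Function.Injective fun j => (v j).natDegree) : wronskianDet v ≠ 0 := by
  intro h0
  have h := coeff_det_of_natDegree_le
    (Matrix.of fun i j : Fin d => X ^ (i : ℕ) * derivative^[(i : ℕ)] (v j))
    (fun j => (v j).natDegree) fun i j => natDegree_X_pow_mul_iterate_derivative_le (v j) i
  rw [← X_pow_mul_wronskianDet, h0, mul_zero, coeff_zero] at h
  simp only [Matrix.of_apply, coeff_X_pow_mul_iterate_derivative] at h
  have h2 := Matrix.det_mul_row (fun j : Fin d => (v j).leadingCoeff)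
    (Matrix.of fun i j : Fin d => (((v j).natDegree.descFactorial i : ℕ) : K))
  simp only [Matrix.of_apply, leadingCoeff] at h2
  simp only [mul_comm (((v _).natDegree.descFactorial _ : ℕ) : K)] at h
  rw [h2] at h
  refine mul_ne_zero (Finset.prod_ne_zero_iff.mpr fun j _ => ?_)
    (det_descFactorial_ne_zero _ hinj) h.symm
  exact leadingCoeff_ne_zero.mpr (hv j)

theorem wronskianDet_update_sub {K : Type*} [Field K] {d : ℕ} (v : Fin d → K[X]) {i j : Fin d}
    (hij : j ≠ i) (c : K) :
    wronskianDet (Function.update v j (v j + c • v i)) = wronskianDet v := by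
  have h := Matrix.det_updateCol_add_smul_self
    (Matrix.of fun i j : Fin d => derivative^[(i : ℕ)] (v j)) hij (C c)
  rw [wronskianDet, wronskianDet, ← h]
  congr 1
  ext1 k l
  by_cases hl : l = j
  · subst hl
    simp [smul_eq_C_mul]
  · simp [hl]

theorem natDegree_cancel_lt {K : Type*} [Field K] {p q : K[X]} (hp : p ≠ 0) (hq : q ≠ 0)
    (h : p.natDegree = q.natDegree)
    (hne : p + (-(p.leadingCoeff / q.leadingCoeff)) • q ≠ 0) :
    (p + (-(p.leadingCoeff / q.leadingCoeff)) • q).natDegree < p.natDegree := by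
  have hq' := leadingCoeff_ne_zero.mpr hq
  have hp' := leadingCoeff_ne_zero.mpr hp
  rw [neg_smul, ← sub_eq_add_neg] at hne ⊢
  have hc : p.leadingCoeff / q.leadingCoeff ≠ 0 := div_ne_zero hp' hq'
  refine (natDegree_lt_natDegree_iff hne).mpr (degree_sub_lt_left ?_ hp ?_)
  · rw [degree_smul_of_smul_regular _ (IsSMulRegular.of_ne_zero hc),
      degree_eq_natDegree hp, degree_eq_natDegree hq, h]
  · rw [leadingCoeff_smul_of_smul_regular _ (IsSMulRegular.of_ne_zero hc), smul_eq_mul,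
      div_mul_cancel₀ _ hq']

/-- Induction on the total of the degrees. If two degrees agree, cancelling one leading term against
the other is a column operation that lowers the total. If all are distinct, the top coefficient is,
up to leading coefficients, a descending-factorial determinant. -/
theorem wronskianDet_ne_zero {K : Type*} [Field K] [CharZero K] {d : ℕ} (v : Fin d → K[X])
    (hv : LinearIndependent K v) : wronskianDet v ≠ 0 := by
  induction hN : ∑ j, (v j).natDegree using Nat.strong_induction_on generalizing v with
  | _ N ih =>
  by_cases hinj : Function.Injective fun j => (v j).natDegree
  · exact wronskianDet_ne_zero_of_injective v hv.ne_zero hinj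
  · simp only [Function.Injective, not_forall] at hinj
    obtain ⟨j, i, hdeg, hji⟩ := hinj
    set c := -((v j).leadingCoeff / (v i).leadingCoeff) with hc
    rw [← wronskianDet_update_sub v hji c]
    have hv' : LinearIndependent K (Function.update v j (v j + c • v i)) := by
      have heq : Function.update v j (v j + c • v i) =
          v + ((Pi.single j c : Fin d → K) · • v i) := by
        ext1 k
        by_cases hk : k = j
        · subst hk
          simp
        · simp [hk]
      rw [heq]
      have h0 : (Pi.single j c : Fin d → K) i = 0 := by simp [Ne.symm hji]
      exact (linearIndependent_add_smul_iff h0).mpr hv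
    have hlt : (v j + c • v i).natDegree < (v j).natDegree :=
      natDegree_cancel_lt (hv.ne_zero j) (hv.ne_zero i) hdeg 
        (by
          have := hv'.ne_zero j
          rwa [Function.update_self] at this)
    refine ih _ ?_ _ hv' rfl
    rw [← hN]
    refine Finset.sum_lt_sum (fun k _ => ?_) ⟨j, Finset.mem_univ j, ?_⟩
    · by_cases hk : k = j
      · subst hk
        simpa using hlt.le
      · simp [hk]
    · simpa using hlt

/-! ### Change of basis, and divisors of the Wronskian of powers -/

theorem wronskianDet_eq_of_mem_span {K : Type*} [Field K] {d : ℕ} (u v : Fin d → K[X])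
    (h : ∀ j, u j ∈ Submodule.span K (Set.range v)) :
    ∃ c : K, wronskianDet u = wronskianDet v * C c := by
  simp only [Submodule.mem_span_range_iff_exists_fun] at h
  choose P hP using h
  refine ⟨(Matrix.of fun k j => P j k).det, ?_⟩
  rw [wronskianDet, wronskianDet, RingHom.map_det, ← Matrix.det_mul]
  congr 1
  ext1 i j
  simp only [Matrix.mul_apply, Matrix.of_apply, ← hP, iterate_derivative_sum,
    smul_eq_C_mul, iterate_derivative_C_mul, RingHom.mapMatrix_apply, Matrix.map_apply]
  exact Finset.sum_congr rfl fun k _ => mul_comm _ _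

theorem natDegree_wronskianDet_add_le_of_mem_span {K : Type*} [Field K] [CharZero K] {d : ℕ}
    (u v : Fin d → K[X]) (hu : LinearIndependent K u)
    (h : ∀ j, u j ∈ Submodule.span K (Set.range v)) :
    (wronskianDet u).natDegree + ∑ i ∈ Finset.range d, i ≤ ∑ j, (v j).natDegree := by
  obtain ⟨c, hc⟩ := wronskianDet_eq_of_mem_span u v h
  have hu0 := wronskianDet_ne_zero u hu
  have hv0 : wronskianDet v ≠ 0 := fun h0 => hu0 (by rw [hc, h0, zero_mul])
  have h1 : (wronskianDet u).natDegree ≤ (wronskianDet v).natDegree := by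
    rw [hc]
    exact natDegree_mul_C_le _ _
  have h2 := natDegree_wronskianDet_add_le v hv0
  omega

theorem prod_pow_dvd_wronskianDet {K : Type*} [Field K] {d : ℕ} (g : Fin d → K[X])
    (e : Fin d → ℕ) :
    ∏ j, g j ^ (e j - (d - 1)) ∣ wronskianDet fun j => g j ^ e j := by
  rw [wronskianDet, Matrix.det_apply]
  refine Finset.dvd_sum fun σ _ => ?_
  rw [Units.smul_def, zsmul_eq_mul]
  refine Dvd.dvd.mul_left (Finset.prod_dvd_prod_of_dvd _ _ fun j _ => ?_) _
  exact (pow_dvd_pow _ (by have := (σ j).isLt; omega)).trans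
    (pow_sub_dvd_iterate_derivative_pow (g j) (e j) (σ j))

/-- Each term of the determinant expansion has one factor from the undifferentiated row. That factor
is a full power `g j ^ e j`, leaving d-1 ≥ 1 spare copies of `g j`, one of which supplies `h`. -/
theorem mul_prod_pow_dvd_wronskianDet {K : Type*} [Field K] {d : ℕ} (hd : 2 ≤ d)
    (g : Fin d → K[X]) (e : Fin d → ℕ) (he : ∀ j, d - 1 ≤ e j) (h : K[X]) (hg : ∀ j, h ∣ g j) :
    h * ∏ j, g j ^ (e j - (d - 1)) ∣ wronskianDet fun j => g j ^ e j := by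
  rw [wronskianDet, Matrix.det_apply]
  refine Finset.dvd_sum fun σ _ => ?_
  rw [Units.smul_def, zsmul_eq_mul]
  refine Dvd.dvd.mul_left ?_ _
  set j₀ : Fin d := σ.symm ⟨0, by omega⟩ with hj₀
  rw [← Finset.mul_prod_erase _ _ (Finset.mem_univ j₀), ← mul_assoc,
    ← Finset.mul_prod_erase Finset.univ (fun i => (Matrix.of _) (σ i) i) (Finset.mem_univ j₀)]
  refine mul_dvd_mul ?_ (Finset.prod_dvd_prod_of_dvd _ _ fun j _ => ?_)
  · have : (σ j₀ : ℕ) = 0 := by rw [hj₀, Equiv.apply_symm_apply]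
    simp only [Matrix.of_apply, this, Function.iterate_zero, id_eq]
    refine (mul_dvd_mul_right (hg j₀) _).trans ?_
    rw [← pow_succ']
    exact pow_dvd_pow _ (by have := he j₀; omega)
  · exact (pow_dvd_pow _ (by have := (σ j).isLt; omega)).trans
      (pow_sub_dvd_iterate_derivative_pow (g j) (e j) (σ j))

/-! ### Greedy bases and nonvanishing subsums -/

/-- The greedy basis: elements are offered in order of decreasing weight and kept when independent
of those before, so above every threshold the kept ones span as much as all. -/
theorem exists_linearIndepOn_forall_span_eq {K V ι α : Type*} [Field K] [AddCommGroup V]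
    [Module K V] [LinearOrder α] (v : ι → V) (w : ι → α) (s : Finset ι) :
    ∃ B ⊆ s, LinearIndepOn K v (B : Set ι) ∧
      Submodule.span K (v '' B) = Submodule.span K (v '' s) ∧
      ∀ t, Submodule.span K (v '' {i | i ∈ B ∧ t < w i}) =
        Submodule.span K (v '' {i | i ∈ s ∧ t < w i}) := by
  classical
  induction s using Finset.induction_on_min_value w with
  | empty => exact ⟨∅, subset_rfl, by simp, rfl, fun t => rfl⟩
  | insert a s ha hmin ih =>
    obtain ⟨B, hBs, hB, hspan, ht⟩ := ih
    have key : ∀ (t : α) (T : Finset ι), ¬ t < w a →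
        {i | i ∈ insert a T ∧ t < w i} = {i | i ∈ T ∧ t < w i} := by
      intro t T hta
      ext i
      simp only [Finset.mem_insert, Set.mem_ofPred_eq]
      constructor
      · rintro ⟨rfl | hi, h⟩
        · exact absurd h hta
        · exact ⟨hi, h⟩
      · exact fun h => ⟨Or.inr h.1, h.2⟩
    have key2 : ∀ (t : α) (T : Finset ι), T ⊆ insert a s → t < w a →
        {i | i ∈ T ∧ t < w i} = (T : Set ι) := by
      intro t T hT hta
      ext i
      simp only [Set.mem_ofPred_eq, Finset.mem_coe, and_iff_left_iff_imp]
      intro hi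
      rcases Finset.mem_insert.mp (hT hi) with rfl | h
      · exact hta
      · exact hta.trans_le (hmin i h)
    by_cases hva : v a ∈ Submodule.span K (v '' s)
    · have hsp : Submodule.span K (v '' B) = Submodule.span K (v '' (insert a s : Finset ι)) := by
        rw [hspan, Finset.coe_insert, Set.image_insert_eq, Submodule.span_insert_eq_span hva]
      refine ⟨B, hBs.trans (Finset.subset_insert a s), hB, hsp, fun t => ?_⟩
      by_cases hta : t < w a
      · rw [key2 t B (hBs.trans (Finset.subset_insert a s)) hta, key2 t _ subset_rfl hta, hsp]
      · rw [key t s hta, ht]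
    · have hsp : Submodule.span K (v '' (insert a B : Finset ι)) =
          Submodule.span K (v '' (insert a s : Finset ι)) := by
        rw [Finset.coe_insert, Finset.coe_insert, Set.image_insert_eq, Set.image_insert_eq,
          Submodule.span_insert, Submodule.span_insert, hspan]
      refine ⟨insert a B, Finset.insert_subset_insert a hBs, ?_, hsp, fun t => ?_⟩
      · rw [Finset.coe_insert]
        exact hB.insert (by rwa [hspan])
      by_cases hta : t < w a
      · rw [key2 t _ (Finset.insert_subset_insert a hBs) hta, key2 t _ subset_rfl hta, hsp]
      · rw [key t s hta, key t B hta, ht]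

theorem finrank_span_image_eq_card {K V ι : Type*} [Field K] [AddCommGroup V] [Module K V]
    {v : ι → V} {B : Finset ι} (hB : LinearIndepOn K v (B : Set ι)) :
    Module.finrank K (Submodule.span K (v '' B)) = B.card := by
  classical
  have h := finrank_span_eq_card hB.linearIndependent
  rw [← Set.image_eq_range] at h
  simpa using h

theorem sum_eq_sum_range_card_filter {ι : Type*} (B : Finset ι) (w : ι → ℕ) (N : ℕ)
    (h : ∀ i ∈ B, w i ≤ N) :
    ∑ i ∈ B, w i = ∑ t ∈ Finset.range N, (B.filter fun i => t < w i).card := by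
  simp only [Finset.card_filter]
  rw [Finset.sum_comm]
  refine Finset.sum_congr rfl fun i hi => ?_
  rw [← Finset.card_filter]
  have : (Finset.range N).filter (fun t => t < w i) = Finset.range (w i) := by
    ext t
    have := h i hi
    simp only [Finset.mem_filter, Finset.mem_range]
    omega
  rw [this, Finset.card_range]

/-- The family `f` together with the sum of all its members, at the index `none`. -/
def adjoinSum {V ι : Type*} [Fintype ι] [AddCommGroup V] (f : ι → V) : Option ι → V :=
  fun o => o.elim (∑ i, f i) f

theorem span_range_adjoinSum (K : Type*) {V ι : Type*} [Field K] [Fintype ι] [AddCommGroup V]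
    [Module K V] (f : ι → V) :
    Submodule.span K (Set.range (adjoinSum f)) = Submodule.span K (Set.range f) := by
  refine le_antisymm (Submodule.span_le.mpr ?_) (Submodule.span_mono ?_)
  · rintro _ ⟨_ | i, rfl⟩
    · exact Submodule.sum_mem _ fun i _ => Submodule.subset_span ⟨i, rfl⟩
    · exact Submodule.subset_span ⟨i, rfl⟩
  · rintro _ ⟨i, rfl⟩
    exact ⟨some i, rfl⟩

/-- The members above weight t and those of the enlarged family at or below t together span
everything. If the total sum is among the latter, the partial sum of the `f i` above t lies in both
spans; it is nonzero when `m` contributes, which gives the extra dimension. -/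
theorem finrank_span_add_finrank_span_ge {K V ι : Type*} [Field K] [Fintype ι] [AddCommGroup V]
    [Module K V] (f : ι → V) (hf : ∀ I : Finset ι, I.Nonempty → ∑ i ∈ I, f i ≠ 0)
    (w : Option ι → ℕ) (m : ι) (t : ℕ) :
    Module.finrank K (Submodule.span K (Set.range f)) +
        (if w none ≤ t ∧ t < w (some m) then 1 else 0) ≤
      Module.finrank K (Submodule.span K (f '' {i | t < w (some i)})) +
        Module.finrank K (Submodule.span K (adjoinSum f '' {o | w o < t + 1})) := by
  classical
  set A := Submodule.span K (f '' {i | t < w (some i)}) with hA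
  set C := Submodule.span K (adjoinSum f '' {o | w o < t + 1}) with hC
  have : FiniteDimensional K A := FiniteDimensional.span_of_finite K (Set.toFinite _)
  have : FiniteDimensional K C := FiniteDimensional.span_of_finite K (Set.toFinite _)
  rw [← Submodule.finrank_sup_add_finrank_inf_eq]
  have hfC : ∀ i, ¬ t < w (some i) → f i ∈ C := fun i hi =>
    Submodule.subset_span ⟨some i, by simpa [Nat.lt_succ_iff] using hi, rfl⟩
  refine add_le_add (Submodule.finrank_mono (Submodule.span_le.mpr ?_)) ?_
  · rintro _ ⟨i, rfl⟩
    by_cases hi : t < w (some i)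
    · exact Submodule.mem_sup_left (Submodule.subset_span ⟨i, hi, rfl⟩)
    · exact Submodule.mem_sup_right (hfC i hi)
  · split_ifs with h
    · set x := ∑ i with t < w (some i), f i with hx
      have hx0 : x ≠ 0 := hf _ ⟨m, by simpa using h.2⟩
      have hxA : x ∈ A := Submodule.sum_mem _ fun i hi =>
        Submodule.subset_span ⟨i, by simpa using hi, rfl⟩
      have hxC : x ∈ C := by
        have hF : ∑ i, f i ∈ C := Submodule.subset_span ⟨none, Nat.lt_succ_of_le h.1, rfl⟩
        rw [← Finset.sum_filter_add_sum_filter_not Finset.univ (fun i => t < w (some i))] at hF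
        refine (Submodule.add_mem_iff_left _ (Submodule.sum_mem _ fun i hi => ?_)).mp hF
        exact hfC i (by simpa using hi)
      rw [Nat.one_le_iff_ne_zero, Ne, Submodule.finrank_eq_zero]
      intro h0
      have : x ∈ A ⊓ C := ⟨hxA, hxC⟩
      rw [h0, Submodule.mem_bot] at this
      exact hx0 this
    · exact Nat.zero_le _

/-- `B` is greedy for large weights and `B'`, via the order dual, for small ones. Each weight is
written as the number of thresholds below it, and the dimension count is summed over thresholds. -/
theorem exists_bases_sum_weight_le {K V ι : Type*} [Field K] [Fintype ι] [AddCommGroup V]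
    [Module K V] (f : ι → V) (hf : ∀ I : Finset ι, I.Nonempty → ∑ i ∈ I, f i ≠ 0)
    (w : Option ι → ℕ) (m : ι) :
    ∃ (B : Finset ι) (B' : Finset (Option ι)),
      LinearIndepOn K f (B : Set ι) ∧ LinearIndepOn K (adjoinSum f) (B' : Set (Option ι)) ∧
      Submodule.span K (f '' B) = Submodule.span K (Set.range f) ∧
      Submodule.span K (adjoinSum f '' B') = Submodule.span K (Set.range f) ∧
      ∑ o ∈ B', w o + w (some m) ≤ ∑ i ∈ B, w (some i) + w none := by
  classical
  obtain ⟨B, -, hB, hBs, hBt⟩ :=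
    exists_linearIndepOn_forall_span_eq (K := K) f (fun i => w (some i)) Finset.univ
  obtain ⟨B', -, hB', hBs', hBt'⟩ := exists_linearIndepOn_forall_span_eq (K := K) (adjoinSum f)
    (fun o => OrderDual.toDual (w o)) Finset.univ
  rw [Finset.coe_univ, Set.image_univ] at hBs hBs'
  rw [span_range_adjoinSum] at hBs'
  refine ⟨B, B', hB, hB', hBs, hBs', ?_⟩
  have hc := finrank_span_image_eq_card hB
  have hc' := finrank_span_image_eq_card hB'
  rw [hBs] at hc
  rw [hBs'] at hc'
  have hcB : ∀ t, Module.finrank K (Submodule.span K (f '' {i | t < w (some i)})) =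
      (B.filter fun i => t < w (some i)).card := fun t => by
    rw [← finrank_span_image_eq_card (hB.mono (Finset.coe_subset.mpr (Finset.filter_subset _ B)))]
    have hs : {i | i ∈ Finset.univ ∧ t < w (some i)} = {i | t < w (some i)} := by
      ext
      simp
    rw [← hs, ← hBt t, Finset.coe_filter]
  have hcB' : ∀ t, Module.finrank K (Submodule.span K (adjoinSum f '' {o | w o < t + 1})) =
      (B'.filter fun o => ¬ t < w o).card := fun t => by
    rw [← finrank_span_image_eq_card
      (hB'.mono (Finset.coe_subset.mpr (Finset.filter_subset _ B')))]
    have hs : {o | o ∈ Finset.univ ∧ OrderDual.toDual (t + 1) < OrderDual.toDual (w o)} =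
        {o | w o < t + 1} := by
      ext
      simp only [Finset.mem_univ, true_and, OrderDual.toDual_lt_toDual]
    have hs' : {o | o ∈ B' ∧ OrderDual.toDual (t + 1) < OrderDual.toDual (w o)} =
        {o | o ∈ B' ∧ ¬ t < w o} := by
      ext
      simp only [OrderDual.toDual_lt_toDual, Nat.lt_succ_iff, not_lt]
    rw [← hs, ← hBt' (OrderDual.toDual (t + 1)), Finset.coe_filter, hs']
  set N := Finset.univ.sup w
  have hwN : ∀ o, w o ≤ N := fun o => Finset.le_sup (Finset.mem_univ o)
  have h1 : ∀ a, a ≤ N → a = ∑ t ∈ Finset.range N, if t < a then 1 else 0 := fun a ha => by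
    have := sum_eq_sum_range_card_filter ({a} : Finset ℕ) id N (by simpa using ha)
    simpa only [Finset.sum_singleton, Finset.card_filter, id] using this
  rw [sum_eq_sum_range_card_filter B' w N fun o _ => hwN o,
    sum_eq_sum_range_card_filter B (fun i => w (some i)) N fun i _ => hwN _,
    h1 _ (hwN (some m)), h1 _ (hwN none), ← Finset.sum_add_distrib, ← Finset.sum_add_distrib]
  refine Finset.sum_le_sum fun t _ => ?_
  have h := finrank_span_add_finrank_span_ge (K := K) f hf w m t
  rw [hcB, hcB', hc'] at h
  have hsplit := Finset.card_filter_add_card_filter_not (s := B') (fun o => t < w o)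
  split_ifs at h ⊢ <;> omega

/-! ### The inequality in one variable -/

theorem mul_le_sub_mul_add_mul (a b c : ℕ) : a * c ≤ (a - b) * c + b * c := by
  rw [← Nat.add_mul]
  exact Nat.mul_le_mul_right c (by omega)

theorem sum_natDegree_pow_add_le {K : Type*} [Field K] [CharZero K] {d : ℕ} (g v : Fin d → K[X])
    (e : Fin d → ℕ) (hg : ∀ j, g j ≠ 0) (hli : LinearIndependent K fun j => g j ^ e j)
    (h : ∀ j, g j ^ e j ∈ Submodule.span K (Set.range v)) :
    ∑ j, (g j ^ e j).natDegree + ∑ i ∈ Finset.range d, i ≤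
      (d - 1) * ∑ j, (g j).natDegree + ∑ j, (v j).natDegree := by
  have hW := wronskianDet_ne_zero _ hli
  have h1 := natDegree_le_of_dvd (prod_pow_dvd_wronskianDet g e) hW
  have h2 := natDegree_wronskianDet_add_le_of_mem_span _ v hli h
  rw [natDegree_prod _ _ fun j _ => pow_ne_zero _ (hg j)] at h1
  simp only [natDegree_pow] at h1 ⊢
  have h3 : ∑ j, e j * (g j).natDegree ≤
      ∑ j, ((e j - (d - 1)) * (g j).natDegree + (d - 1) * (g j).natDegree) :=
    Finset.sum_le_sum fun j _ => mul_le_sub_mul_add_mul _ _ _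
  rw [Finset.sum_add_distrib, ← Finset.mul_sum] at h3
  omega

theorem sum_natDegree_pow_add_lt {K : Type*} [Field K] [CharZero K] {d : ℕ} (hd : 2 ≤ d)
    (g v : Fin d → K[X]) (e : Fin d → ℕ) (hg : ∀ j, g j ≠ 0)
    (hli : LinearIndependent K fun j => g j ^ e j)
    (h : ∀ j, g j ^ e j ∈ Submodule.span K (Set.range v))
    (q : K[X]) (hq : 1 ≤ q.natDegree) (hqg : ∀ j, q ∣ g j) :
    ∑ j, (g j ^ e j).natDegree + ∑ i ∈ Finset.range d, i <
      (d - 1) * ∑ j, (g j).natDegree + ∑ j, (v j).natDegree := by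
  have hW := wronskianDet_ne_zero _ hli
  have h2 := natDegree_wronskianDet_add_le_of_mem_span _ v hli h
  by_cases he : ∀ j, d - 1 ≤ e j
  · have h1 := natDegree_le_of_dvd (mul_prod_pow_dvd_wronskianDet hd g e he q hqg) hW
    have hq0 : q ≠ 0 := by
      rintro rfl
      simp at hq
    rw [natDegree_mul hq0 (Finset.prod_ne_zero_iff.mpr fun j _ => pow_ne_zero _ (hg j)),
      natDegree_prod _ _ fun j _ => pow_ne_zero _ (hg j)] at h1
    simp only [natDegree_pow] at h1 ⊢
    have h3 : ∑ j, e j * (g j).natDegree ≤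
        ∑ j, ((e j - (d - 1)) * (g j).natDegree + (d - 1) * (g j).natDegree) :=
      Finset.sum_le_sum fun j _ => mul_le_sub_mul_add_mul _ _ _
    rw [Finset.sum_add_distrib, ← Finset.mul_sum] at h3
    omega
  · push Not at he
    obtain ⟨j₀, hj₀⟩ := he
    have h1 := natDegree_le_of_dvd (prod_pow_dvd_wronskianDet g e) hW
    rw [natDegree_prod _ _ fun j _ => pow_ne_zero _ (hg j)] at h1
    simp only [natDegree_pow] at h1 ⊢
    -- For `e j₀ < d - 1` the truncated difference is 0, so the strictness comes from the exponent
    -- alone.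
    have h3 : ∑ j, e j * (g j).natDegree <
        ∑ j, ((e j - (d - 1)) * (g j).natDegree + (d - 1) * (g j).natDegree) := by
      refine Finset.sum_lt_sum (fun j _ => mul_le_sub_mul_add_mul _ _ _)
        ⟨j₀, Finset.mem_univ _, ?_⟩
      rw [← Nat.add_mul]
      exact Nat.mul_lt_mul_of_pos_right (by omega)
        (hq.trans (natDegree_le_of_dvd (hqg j₀) (hg j₀)))
    rw [Finset.sum_add_distrib, ← Finset.mul_sum] at h3
    omega

theorem sum_comp_equivFinOfCardEq_symm {ι M : Type*} [AddCommMonoid M] {B : Finset ι} {d : ℕ}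
    (h : B.card = d) (φ : ι → M) :
    ∑ j, φ ((B.equivFinOfCardEq h).symm j) = ∑ i ∈ B, φ i := by
  rw [Equiv.sum_comp (B.equivFinOfCardEq h).symm fun i : B => φ i, Finset.sum_coe_sort]

theorem exists_card_eq_finrank_natDegree_add_le {K ι : Type*} [Field K] [CharZero K] [Fintype ι]
    (g : ι → K[X]) (e : ι → ℕ) (hg : ∀ i, g i ≠ 0)
    (hsub : ∀ I : Finset ι, I.Nonempty → ∑ i ∈ I, g i ^ e i ≠ 0) (m : ι) {d : ℕ}
    (hd : Module.finrank K (Submodule.span K (Set.range fun i => g i ^ e i)) = d) :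
    ∃ B : Finset ι, B.card = d ∧
      (g m ^ e m).natDegree + ∑ i ∈ Finset.range d, i ≤
        (d - 1) * ∑ i ∈ B, (g i).natDegree + (∑ i, g i ^ e i).natDegree ∧
      (2 ≤ d → ∀ q : K[X], 1 ≤ q.natDegree → (∀ i, q ∣ g i) →
        (g m ^ e m).natDegree + ∑ i ∈ Finset.range d, i <
          (d - 1) * ∑ i ∈ B, (g i).natDegree + (∑ i, g i ^ e i).natDegree) := by
  obtain ⟨B, B', hB, hB', hBs, hBs', hw⟩ := exists_bases_sum_weight_le (K := K) (fun i => g i ^ e i) hsub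
    (fun o => (adjoinSum (fun i => g i ^ e i) o).natDegree) m
  have hc : B.card = d := by rw [← finrank_span_image_eq_card hB, hBs, hd]
  have hc' : B'.card = d := by rw [← finrank_span_image_eq_card hB', hBs', hd]
  set σ := (B.equivFinOfCardEq hc).symm
  set τ := (B'.equivFinOfCardEq hc').symm
  have hli : LinearIndependent K fun j => g (σ j) ^ e (σ j) :=
    hB.linearIndependent.comp σ σ.injective
  have hmem : ∀ j, g (σ j) ^ e (σ j) ∈
      Submodule.span K (Set.range fun j => adjoinSum (fun i => g i ^ e i) (τ j)) := by
    intro j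
    have hr : (Set.range fun j => adjoinSum (fun i => g i ^ e i) (τ j)) = adjoinSum (fun i => g i ^ e i) '' B' := by
      rw [Set.image_eq_range]
      exact τ.surjective.range_comp fun o : B' => adjoinSum (fun i => g i ^ e i) o
    rw [hr, hBs']
    exact Submodule.subset_span ⟨σ j, rfl⟩
  have e1 : ∑ j, (g (σ j) ^ e (σ j)).natDegree = ∑ i ∈ B, (g i ^ e i).natDegree :=
    sum_comp_equivFinOfCardEq_symm hc fun i => (g i ^ e i).natDegree
  have e2 : ∑ j, (g (σ j)).natDegree = ∑ i ∈ B, (g i).natDegree :=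
    sum_comp_equivFinOfCardEq_symm hc fun i => (g i).natDegree
  have e3 : ∑ j, (adjoinSum (fun i => g i ^ e i) (τ j)).natDegree = ∑ o ∈ B', (adjoinSum (fun i => g i ^ e i) o).natDegree :=
    sum_comp_equivFinOfCardEq_symm hc' fun o => (adjoinSum (fun i => g i ^ e i) o).natDegree
  have hw' : ∑ o ∈ B', (adjoinSum (fun i => g i ^ e i) o).natDegree + (g m ^ e m).natDegree ≤
      ∑ i ∈ B, (g i ^ e i).natDegree + (∑ i, g i ^ e i).natDegree := hw
  refine ⟨B, hc, ?_, fun hd2 q hq hqg => ?_⟩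
  · have h := sum_natDegree_pow_add_le (fun j => g (σ j)) _ (fun j => e (σ j))
      (fun j => hg _) hli hmem
    rw [e1, e2, e3] at h
    omega
  · have h := sum_natDegree_pow_add_lt hd2 (fun j => g (σ j)) _ (fun j => e (σ j))
      (fun j => hg _) hli hmem q hq fun j => hqg _
    rw [e1, e2, e3] at h
    omega

/-- Passing from k to k+1 adds k on the left and S on the right, and k ≤ S throughout the range. -/
theorem sum_range_add_mul_le {d d' S : ℕ} (hd : 1 ≤ d) (hdd' : d ≤ d') (hS : d' ≤ S + 1) :
    ∑ i ∈ Finset.range d', i + (d - 1) * S ≤ (d' - 1) * S + ∑ i ∈ Finset.range d, i := by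
  induction d', hdd' using Nat.le_induction with
  | base => omega
  | succ k hk ih =>
    have := ih (by omega)
    have hk' : (k + 1 - 1) * S = (k - 1) * S + S := by
      rw [← Nat.succ_mul]
      congr 1
      omega
    rw [Finset.sum_range_succ, hk']
    omega

theorem card_le_sum_add_card_filter_eq_zero {ι : Type*} [Fintype ι] (w : ι → ℕ) :
    Fintype.card ι ≤ ∑ i, w i + (Finset.univ.filter fun i => w i = 0).card := by
  rw [Finset.card_filter, ← Finset.sum_add_distrib, Fintype.card_eq_sum_ones]
  refine Finset.sum_le_sum fun i _ => ?_
  split_ifs with h <;> omega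

theorem natDegree_add_sum_range_le {K ι : Type*} [Field K] [CharZero K] [Fintype ι]
    (g : ι → K[X]) (e : ι → ℕ) (hg : ∀ i, g i ≠ 0)
    (hsub : ∀ I : Finset ι, I.Nonempty → ∑ i ∈ I, g i ^ e i ≠ 0) (m : ι) {d' : ℕ} (hd2 : 2 ≤ d')
    (hd : Module.finrank K (Submodule.span K (Set.range fun i => g i ^ e i)) ≤ d')
    (hd' : d' + (Finset.univ.filter fun i => (g i).natDegree = 0).card ≤ Fintype.card ι + 1) :
    (g m ^ e m).natDegree + ∑ i ∈ Finset.range d', i ≤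
        (d' - 1) * ∑ i, (g i).natDegree + (∑ i, g i ^ e i).natDegree ∧
      (2 ≤ Fintype.card ι → ∀ q : K[X], 1 ≤ q.natDegree → (∀ i, q ∣ g i) →
        (g m ^ e m).natDegree + ∑ i ∈ Finset.range d', i <
          (d' - 1) * ∑ i, (g i).natDegree + (∑ i, g i ^ e i).natDegree) := by
  obtain ⟨d, hdd⟩ : ∃ d, Module.finrank K
    (Submodule.span K (Set.range fun i => g i ^ e i)) = d := ⟨_, rfl⟩
  rw [hdd] at hd
  obtain ⟨B, hB, hle, hlt⟩ := exists_card_eq_finrank_natDegree_add_le g e hg hsub m hdd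
  have hd1 : 1 ≤ d := by
    have : FiniteDimensional K (Submodule.span K (Set.range fun i => g i ^ e i)) :=
      FiniteDimensional.span_of_finite K (Set.toFinite _)
    rw [← hdd, Nat.one_le_iff_ne_zero, Ne, Submodule.finrank_eq_zero]
    intro h0
    have hm : g m ^ e m ∈ Submodule.span K (Set.range fun i => g i ^ e i) :=
      Submodule.subset_span ⟨m, rfl⟩
    rw [h0, Submodule.mem_bot] at hm
    exact hsub {m} (Finset.singleton_nonempty m) (by simpa using hm)
  have hcard := card_le_sum_add_card_filter_eq_zero fun i => (g i).natDegree
  set S := ∑ i, (g i).natDegree with hS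
  have hS1 : d' ≤ S + 1 := by omega
  have hBS : ∑ i ∈ B, (g i).natDegree ≤ S :=
    Finset.sum_le_sum_of_subset (Finset.subset_univ B)
  have hBS' := Nat.mul_le_mul_left (d - 1) hBS
  have hmono := sum_range_add_mul_le hd1 hd hS1
  refine ⟨by omega, fun hn q hq hqg => ?_⟩
  have hg1 : ∀ i, 1 ≤ (g i).natDegree := fun i =>
    hq.trans (natDegree_le_of_dvd (hqg i) (hg i))
  by_cases h2 : 2 ≤ d
  · have := hlt h2 q hq hqg
    omega
  -- The Wronskian gives no strictness here. The step from d = 1 to 2 does: it gains S on the right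
  -- against 1 on the left, and S ≥ 2.
  · obtain rfl : d = 1 := by omega
    have hSn : Fintype.card ι ≤ S := by
      rw [Fintype.card_eq_sum_ones]
      exact Finset.sum_le_sum fun i _ => hg1 i
    have hmono2 := sum_range_add_mul_le one_le_two hd2 hS1
    have h2 : ∑ i ∈ Finset.range 2, i = 1 := rfl
    rw [h2] at hmono2
    rw [Finset.sum_range_one] at hle
    omega

/-! ### Reduction to a generic line -/

/-- Restriction of a polynomial to the line through the origin with direction `b`. -/
noncomputable def restrictLine {K σ : Type*} [Field K] (b : σ → K) :
    MvPolynomial σ K →ₐ[K] K[X] :=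
  MvPolynomial.aeval fun i => C (b i) * X

theorem restrictLine_dvd_restrictLine {K σ : Type*} [Field K] (b : σ → K)
    {p q : MvPolynomial σ K} (h : p ∣ q) : restrictLine b p ∣ restrictLine b q := by
  obtain ⟨c, rfl⟩ := h
  exact ⟨restrictLine b c, map_mul _ _ _⟩

theorem coeff_restrictLine {K σ : Type*} [Field K] (b : σ → K) (p : MvPolynomial σ K) (k : ℕ) :
    (restrictLine b p).coeff k = MvPolynomial.eval b (MvPolynomial.homogeneousComponent k p) := by
  induction p using MvPolynomial.induction_on' with
  | monomial u a =>
    have h : restrictLine b (MvPolynomial.monomial u a) =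
        C (a * u.prod fun i n => b i ^ n) * X ^ u.degree := by
      rw [restrictLine, MvPolynomial.aeval_monomial]
      simp only [Finsupp.prod, mul_pow, Finset.prod_mul_distrib, Finset.prod_pow_eq_pow_sum,
        Finsupp.degree, map_mul, map_prod, map_pow, mul_assoc]
      rfl
    rw [h, coeff_C_mul_X_pow, MvPolynomial.homogeneousComponent_of_mem
      (MvPolynomial.isHomogeneous_monomial a rfl)]
    split_ifs with hk
    · rw [MvPolynomial.eval_monomial]
    · rw [map_zero]
  | add p q hp hq => rw [map_add, coeff_add, hp, hq, map_add, map_add]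

theorem homogeneousComponent_totalDegree_ne_zero {K σ : Type*} [Field K] {p : MvPolynomial σ K}
    (hp : p ≠ 0) : MvPolynomial.homogeneousComponent p.totalDegree p ≠ 0 := by
  obtain ⟨u, hu, hdeg⟩ := Finset.exists_mem_eq_sup p.support
    (MvPolynomial.support_nonempty.mpr hp) fun u => u.sum fun _ n => n
  intro h0
  have h := congrArg (MvPolynomial.coeff u) h0
  have hdeg' : u.degree = p.totalDegree := hdeg.symm
  rw [MvPolynomial.coeff_homogeneousComponent, if_pos hdeg', MvPolynomial.coeff_zero] at h
  exact MvPolynomial.mem_support_iff.mp hu h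

/-- The degree survives when the top homogeneous component does not vanish at `b`. The product of
these components is a nonzero polynomial, so over an infinite field some `b` avoids all their zeros.
-/
theorem exists_forall_natDegree_restrictLine_eq {K σ : Type*} [Field K] [Infinite K]
    (s : Finset (MvPolynomial σ K)) (hs : ∀ p ∈ s, p ≠ 0) :
    ∃ b : σ → K, ∀ p ∈ s, restrictLine b p ≠ 0 ∧
      (restrictLine b p).natDegree = p.totalDegree := by
  have hprod : ∏ p ∈ s, MvPolynomial.homogeneousComponent p.totalDegree p ≠ 0 :=
    Finset.prod_ne_zero_iff.mpr fun p hp => homogeneousComponent_totalDegree_ne_zero (hs p hp)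
  obtain ⟨b, hb⟩ : ∃ b : σ → K, MvPolynomial.eval b
      (∏ p ∈ s, MvPolynomial.homogeneousComponent p.totalDegree p) ≠ 0 := by
    by_contra! h
    exact hprod (MvPolynomial.funext fun x => by rw [h x, map_zero])
  rw [map_prod, Finset.prod_ne_zero_iff] at hb
  refine ⟨b, fun p hp => ?_⟩
  have hc : (restrictLine b p).coeff p.totalDegree ≠ 0 := by
    rw [coeff_restrictLine]
    exact hb p hp
  refine ⟨fun h0 => hc (by rw [h0, coeff_zero]), le_antisymm ?_ (le_natDegree_of_ne_zero hc)⟩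
  refine natDegree_le_iff_coeff_eq_zero.mpr fun k hk => ?_
  rw [coeff_restrictLine, MvPolynomial.homogeneousComponent_eq_zero _ _ hk, map_zero]

theorem exists_restrictLine_family {K σ ι : Type*} [Field K] [Infinite K] [Fintype ι]
    (g : ι → MvPolynomial σ K) (e : ι → ℕ) (hg : ∀ i, g i ≠ 0)
    (hsub : ∀ I : Finset ι, I.Nonempty → ∑ i ∈ I, g i ^ e i ≠ 0)
    (q : MvPolynomial σ K) (hq0 : q ≠ 0) :
    ∃ b : σ → K, (restrictLine b q).natDegree = q.totalDegree ∧
      (∀ i, restrictLine b (g i) ≠ 0 ∧ (restrictLine b (g i)).natDegree = (g i).totalDegree) ∧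
      ∀ I : Finset ι, I.Nonempty → ∑ i ∈ I, restrictLine b (g i) ^ e i ≠ 0 ∧
        (∑ i ∈ I, restrictLine b (g i) ^ e i).natDegree = (∑ i ∈ I, g i ^ e i).totalDegree := by
  classical
  obtain ⟨b, hb⟩ := exists_forall_natDegree_restrictLine_eq
    (insert q (Finset.univ.image g ∪ (Finset.univ.filter Finset.Nonempty).image
      fun I : Finset ι => ∑ i ∈ I, g i ^ e i)) (by
    intro p hp
    simp only [Finset.mem_insert, Finset.mem_union, Finset.mem_image, Finset.mem_univ, true_and,
      Finset.mem_filter] at hp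
    rcases hp with rfl | ⟨i, rfl⟩ | ⟨I, hI, rfl⟩
    · exact hq0
    · exact hg i
    · exact hsub I hI)
  refine ⟨b, (hb q (Finset.mem_insert_self _ _)).2, fun i => hb _ (by simp), fun I hI => ?_⟩
  have := hb (∑ i ∈ I, g i ^ e i) (Finset.mem_insert_of_mem (Finset.mem_union_right _
    (Finset.mem_image_of_mem _ (by simpa using hI))))
  simpa only [map_sum, map_pow] using this

theorem exists_dvd_of_not_gcdEqOne {l n : ℕ} (g : Fin n → MvPolynomial (Fin l) ℂ) (m : Fin n)
    (hm : g m ≠ 0) :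
    ∃ q : MvPolynomial (Fin l) ℂ, q ≠ 0 ∧ (∀ i, q ∣ g i) ∧
      (¬ GcdEqOne g → 1 ≤ q.totalDegree) := by
  by_cases hgcd : GcdEqOne g
  · exact ⟨1, one_ne_zero, fun i => one_dvd _, fun h => absurd hgcd h⟩
  · unfold GcdEqOne at hgcd
    push Not at hgcd
    obtain ⟨q, hqg, hqu⟩ := hgcd
    have hq0 : q ≠ 0 := fun h0 => hm (zero_dvd_iff.mp (h0 ▸ hqg m))
    refine ⟨q, hq0, hqg, fun _ => Nat.one_le_iff_ne_zero.mpr fun hdeg => hqu ?_⟩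
    rw [MvPolynomial.totalDegree_eq_zero_iff_eq_C] at hdeg
    rw [hdeg] at hq0 ⊢
    refine IsUnit.map MvPolynomial.C (isUnit_iff_ne_zero.mpr fun h0 => hq0 ?_)
    rw [h0, map_zero]

theorem totalDegree_add_sum_range_le {l n : ℕ} (g : Fin n → MvPolynomial (Fin l) ℂ) (e : Fin n → ℕ)
    (he : ∀ i, 1 ≤ e i)
    (hsub : ∀ I : Finset (Fin n), I.Nonempty → ∑ i ∈ I, g i ^ e i ≠ 0) (m : Fin n)
    (d' : ℕ) (hd'2 : 2 ≤ d') (hdd' : spanDim (fun i => g i ^ e i) ≤ d')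
    (hd'n : d' + numConstant g ≤ n + 1) :
    (g m ^ e m).totalDegree + ∑ i ∈ Finset.range d', i ≤
        (d' - 1) * ∑ i, (g i).totalDegree + (∑ i, g i ^ e i).totalDegree ∧
      (2 ≤ n → ¬ GcdEqOne g →
        (g m ^ e m).totalDegree + ∑ i ∈ Finset.range d', i <
          (d' - 1) * ∑ i, (g i).totalDegree + (∑ i, g i ^ e i).totalDegree) := by
  have hg : ∀ i, g i ≠ 0 := fun i h0 => hsub {i} (Finset.singleton_nonempty i) (by
    rw [Finset.sum_singleton, h0, zero_pow (by have := he i; omega)])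
  obtain ⟨q, hq0, hqg, hqu⟩ := exists_dvd_of_not_gcdEqOne g m (hg m)
  obtain ⟨b, hbq, hbg, hbI⟩ := exists_restrictLine_family g e hg hsub q hq0
  -- Restriction may lower the dimension of the span; only the upper bound `d'` is needed.
  have hfin : Module.finrank ℂ
      (Submodule.span ℂ (Set.range fun i => restrictLine b (g i) ^ e i)) ≤ d' := by
    have : FiniteDimensional ℂ (Submodule.span ℂ (Set.range fun i => g i ^ e i)) :=
      FiniteDimensional.span_of_finite ℂ (Set.toFinite _)
    have hr : (Set.range fun i => restrictLine b (g i) ^ e i) =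
        (restrictLine b).toLinearMap '' Set.range fun i => g i ^ e i := by
      rw [← Set.range_comp]
      congr 1
      ext1 i
      simp
    rw [hr, ← Submodule.map_span]
    exact (Submodule.finrank_map_le _ _).trans hdd'
  have hconst : d' + (Finset.univ.filter fun i => (restrictLine b (g i)).natDegree = 0).card ≤
      Fintype.card (Fin n) + 1 := by
    simp only [(hbg _).2, Fintype.card_fin]
    exact hd'n
  obtain ⟨h1, h2⟩ := natDegree_add_sum_range_le (fun i => restrictLine b (g i)) e
    (fun i => (hbg i).1) (fun I hI => (hbI I hI).1) m hd'2 hfin hconst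
  have hm := (hbI {m} (Finset.singleton_nonempty m)).2
  rw [Finset.sum_singleton, Finset.sum_singleton] at hm
  have hF := (hbI Finset.univ ⟨m, Finset.mem_univ m⟩).2
  have hS : ∑ i, (restrictLine b (g i)).natDegree = ∑ i, (g i).totalDegree :=
    Finset.sum_congr rfl fun i _ => (hbg i).2
  rw [hm, hF, hS] at h1
  rw [hm, hF, hS, Fintype.card_fin] at h2
  refine ⟨h1, fun hn hgcd => h2 hn (restrictLine b q) ?_ fun i =>
    restrictLine_dvd_restrictLine b (hqg i)⟩
  rw [hbq]
  exact hqu hgcd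

/-! ### Passage to the real inequality -/

theorem totalDegree_pow_of_ne_zero {K σ : Type*} [Field K] {p : MvPolynomial σ K} (hp : p ≠ 0)
    (k : ℕ) : (p ^ k).totalDegree = k * p.totalDegree := by
  induction k with
  | zero => simp
  | succ k ih =>
    rw [pow_succ, MvPolynomial.totalDegree_mul_of_isDomain (pow_ne_zero k hp) hp, ih, Nat.succ_mul]

theorem totalDegree_le_maxDegree_div {l n : ℕ} (g : Fin n → MvPolynomial (Fin l) ℂ)
    (e : Fin n → ℕ) (i : Fin n) (hg : g i ≠ 0)
    (he : 1 ≤ e i) :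
    ((g i).totalDegree : ℝ) ≤ 1 / (e i : ℝ) * maxDegree fun i => g i ^ e i := by
  have h : e i * (g i).totalDegree ≤ maxDegree fun i => g i ^ e i := by
    rw [← totalDegree_pow_of_ne_zero hg]
    exact Finset.le_sup (f := fun i => (g i ^ e i).totalDegree) (Finset.mem_univ i)
  have he' : (0 : ℝ) < e i := by exact_mod_cast he
  rw [one_div, inv_mul_eq_div, le_div_iff₀ he', mul_comm]
  exact_mod_cast h

end PowerSum

theorem mainTheorem9 {l n : ℕ} (g : Fin n → MvPolynomial (Fin l) ℂ) (e : Fin n → ℕ)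
    (he : ∀ i, 1 ≤ e i)
    (hsum : ∑ i, g i ^ e i ≠ 0)
    (hsub : ∀ I : Finset (Fin n), I.Nonempty → ∑ i ∈ I, g i ^ e i ≠ 0)
    (d' : ℕ) (hd'2 : 2 ≤ d')
    (hdd' : PowerSum.spanDim (fun i => g i ^ e i) ≤ d')
    (hd'n : d' + PowerSum.numConstant g ≤ n + 1) :
    ((∑ i, 1 / (e i : ℝ)) - 1 / ((d' : ℝ) - 1)) *
          (PowerSum.maxDegree (fun i => g i ^ e i) : ℝ) ≥
        (d' : ℝ) / 2 - 1 / ((d' : ℝ) - 1) * ((∑ i, g i ^ e i).totalDegree : ℝ) ∧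
      (2 ≤ n → ¬ PowerSum.GcdEqOne g →
        ((∑ i, 1 / (e i : ℝ)) - 1 / ((d' : ℝ) - 1)) *
            (PowerSum.maxDegree (fun i => g i ^ e i) : ℝ) ≠
          (d' : ℝ) / 2 - 1 / ((d' : ℝ) - 1) * ((∑ i, g i ^ e i).totalDegree : ℝ)) := by
  have hne : (Finset.univ : Finset (Fin n)).Nonempty := by
    by_contra h
    rw [Finset.not_nonempty_iff_eq_empty] at h
    exact hsum (by rw [h, Finset.sum_empty])
  obtain ⟨m, -, hm⟩ := Finset.exists_mem_eq_sup Finset.univ hne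
    fun i => (g i ^ e i).totalDegree
  change PowerSum.maxDegree (fun i => g i ^ e i) = _ at hm
  obtain ⟨hle, hlt⟩ := PowerSum.totalDegree_add_sum_range_le g e he hsub m d' hd'2 hdd' hd'n
  rw [← hm] at hle hlt
  have hg : ∀ i, g i ≠ 0 := fun i h0 => hsub {i} (Finset.singleton_nonempty i) (by
    rw [Finset.sum_singleton, h0, zero_pow (by have := he i; omega)])
  have hS : (∑ i, ((g i).totalDegree : ℝ)) ≤
      (∑ i, 1 / (e i : ℝ)) * PowerSum.maxDegree fun i => g i ^ e i := by
    rw [Finset.sum_mul]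
    exact Finset.sum_le_sum fun i _ => PowerSum.totalDegree_le_maxDegree_div g e i (hg i) (he i)
  have hT : ((∑ i ∈ Finset.range d', i : ℕ) : ℝ) = d' * ((d' : ℝ) - 1) / 2 := by
    have h := Finset.sum_range_id_mul_two d'
    have h' : ((∑ i ∈ Finset.range d', i : ℕ) : ℝ) * 2 = d' * ((d' - 1 : ℕ) : ℝ) := by
      exact_mod_cast h
    rw [Nat.cast_sub (by omega), Nat.cast_one] at h'
    linarith
  have hx : (0 : ℝ) < (d' : ℝ) - 1 := by
    have : (2 : ℝ) ≤ d' := by exact_mod_cast hd'2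
    linarith
  have hx' : ((d' - 1 : ℕ) : ℝ) = (d' : ℝ) - 1 := by rw [Nat.cast_sub (by omega), Nat.cast_one]
  set M := PowerSum.maxDegree fun i => g i ^ e i
  set E := ∑ i, 1 / (e i : ℝ)
  set x := (d' : ℝ) - 1
  set D := (∑ i, g i ^ e i).totalDegree
  -- Multiplying by x = d'-1 > 0 turns the difference of the two sides into that of the integer
  -- inequality, with ∑ deg g_i replaced by its upper bound E * M.
  have hdiff : x * ((E - 1 / x) * M - ((d' : ℝ) / 2 - 1 / x * D)) =
      (x * (E * M) + D) - (M + d' * x / 2) := by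
    field_simp
    ring
  have hxS := mul_le_mul_of_nonneg_left hS hx.le
  refine ⟨?_, fun hn hgcd heq => ?_⟩
  · have h := (Nat.cast_le (α := ℝ)).mpr hle
    rw [Nat.cast_add, hT, Nat.cast_add, Nat.cast_mul, hx', Nat.cast_sum] at h
    refine sub_nonneg.mp ((mul_nonneg_iff_of_pos_left hx).mp ?_)
    rw [hdiff]
    linarith
  · have h := (Nat.cast_lt (α := ℝ)).mpr (hlt hn hgcd)
    rw [Nat.cast_add, hT, Nat.cast_add, Nat.cast_mul, hx', Nat.cast_sum] at h
    rw [heq, sub_self, mul_zero] at hdiff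
    linarith
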